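/- A closed halfspace of $\mathbb{R}^d$ is a set $\{x : \langle a,x\rangle \le b\}$ with $a\in\mathbb{R}^d\setminus\{0\}$ and $b\in\mathbb{R}$. An $(n,d)$-polytope is a bounded subset of $\mathbb{R}^d$ with nonempty interior that is the intersection of $n$ closed halfspaces, none of which can be omitted without changing the intersection. A face of a polytope $P$ is $\emptyset$, $P$ itself, or the intersection of $P$ with a supporting hyperplane; two polytopes are combinatorially equivalent if their posets of faces, ordered by inclusion, are isomorphic. Theorem. Let $P\subset\mathbb{R}^d$ be an $(n,d)$-polytope (simple or not) that is not a $d$-simplex. Then $n\ge 1$, and there are an $(n-1,d)$-polytope $Q\subset\mathbb{R}^d$ (a parent of $P$) and a closed halfspace $H\subset\mathbb{R}^d$ such that $Q\cap H$ is an $(n,d)$-polytope combinatorially equivalent to $P$. -/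

import Mathlib

/-- A closed halfspace `{x | ⟪a, x⟫ ≤ b}`, `a ≠ 0`, of `ℝ^d`. -/
def IsClosedHalfspace {d : ℕ} (H : Set (EuclideanSpace ℝ (Fin d))) : Prop :=
  ∃ (a : EuclideanSpace ℝ (Fin d)) (b : ℝ), a ≠ 0 ∧ H = {x | inner ℝ a x ≤ b}

/-- An `(n,d)`-polytope: a bounded, full-dimensional subset of `ℝ^d` that is the intersection of
`n` closed halfspaces, none of which is redundant. -/
structure IsNDPolytope (n d : ℕ) (P : Set (EuclideanSpace ℝ (Fin d))) : Prop where
  /-- `P` is bounded. -/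
  bounded : Bornology.IsBounded P
  /-- `P` is `d`-dimensional: a convex subset of `ℝ^d` has dimension `d` iff its interior is
  nonempty. -/
  fullDim : (interior P).Nonempty
  /-- `P` is cut out by `n` halfspaces, and dropping any one of them changes the set. -/
  exists_halfspaces : ∃ H : Fin n → Set (EuclideanSpace ℝ (Fin d)),
    (∀ i, IsClosedHalfspace (H i)) ∧ P = ⋂ i, H i ∧ ∀ i, (⋂ j ∈ {j | j ≠ i}, H j) ≠ P

/-- The face poset of `P`, ordered by inclusion. An exposed subset of `P` is the empty set or
the set of maximizers over `P` of a linear functional `l`; the functional `l = 0` gives `P`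
itself, and `l ≠ 0` gives the nonempty intersections of `P` with supporting hyperplanes. -/
abbrev FacePoset {d : ℕ} (P : Set (EuclideanSpace ℝ (Fin d))) : Type :=
  {F : Set (EuclideanSpace ℝ (Fin d)) // IsExposed ℝ P F}

/-- Two polytopes have the same combinatorial type if their face posets are isomorphic. -/
def CombinatoriallyEquivalent {d : ℕ} (P Q : Set (EuclideanSpace ℝ (Fin d))) : Prop :=
  Nonempty (FacePoset P ≃o FacePoset Q)

/-- `P` is a `d`-simplex: the convex hull of `d + 1` affinely independent points. -/
def IsDSimplex {d : ℕ} (P : Set (EuclideanSpace ℝ (Fin d))) : Prop :=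
  ∃ s : Affine.Simplex ℝ (EuclideanSpace ℝ (Fin d)) d, P = convexHull ℝ (Set.range s.points)

/-!
# Every polytope other than a simplex arises from a parent by one cut

Place an interior point of the polytope at the origin and rescale its inequalities, so that it
becomes `{x | ∀ j, ⟪a j, x⟫ ≤ 1}` (`IsNDPolytope.exists_eq_polarPolyhedron`); thus it is the polar
of its normals `a j`.

If the normals are affinely independent, then, since a bounded polyhedron has no recession
direction, they form an affine basis in which the origin has positive coordinates. The polar is
then a simplex whose vertices are read off from the barycentric coordinate functionals
(`isDSimplex_of_affineBasis`).

Otherwise some normal `a i` is an affine combination of the others. The projective map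
`x ↦ x / (1 - ⟪c, x⟫)` carries the polar of `a j` to the polar of `a j - c`, preserving the face
poset (`nonempty_orderIso_isExposed_translate`). Let `c` be the mean of the `a j` with `j ≠ i`.
The vectors `a j - c` with `j ≠ i` sum to zero, and they span because the `a j` with `j ≠ i` have
the same affine span as all the `a j`. Hence their polar is bounded
(`isBounded_polarPolyhedron_of_sum_eq_zero`, `exists_translate`): after the projective
transformation the `i`-th inequality can be dropped without losing boundedness. Irredundancy
survives, because each facet has a point where only its own inequality is tight
(`HasFacetPoints.translate`).
-/

open scoped InnerProductSpace

/-! ### Polars of finite families -/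

section Polar

variable {E : Type*} [NormedAddCommGroup E] [InnerProductSpace ℝ E] {ι : Type*}

/-- The polyhedron `{x | ∀ j, ⟪a j, x⟫ ≤ 1}`, i.e. the polar of the family `a`. -/
def polarPolyhedron (a : ι → E) : Set E := {x | ∀ j, ⟪a j, x⟫_ℝ ≤ 1}

/-- Every inequality `⟪a i, x⟫ ≤ 1` is attained at a point where all the others are strict. Such a
point lies in the relative interior of the `i`-th facet, so this is a form of irredundancy; unlike
the set-theoretic one, it visibly passes to subfamilies and to projective images. -/
def HasFacetPoints (a : ι → E) : Prop :=
  ∀ i, ∃ x, ⟪a i, x⟫_ℝ = 1 ∧ ∀ j, j ≠ i → ⟪a j, x⟫_ℝ < 1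

lemma HasFacetPoints.ne_zero {a : ι → E} (h : HasFacetPoints a) (i : ι) : a i ≠ 0 := by
  intro h0
  obtain ⟨x, hx, -⟩ := h i
  simp [h0] at hx

lemma HasFacetPoints.comp {κ : Type*} {a : ι → E} (h : HasFacetPoints a) {e : κ → ι}
    (he : Function.Injective e) : HasFacetPoints (a ∘ e) := by
  intro k
  obtain ⟨x, hx, hx'⟩ := h (e k)
  exact ⟨x, hx, fun j hj => hx' _ (he.ne hj)⟩

lemma HasFacetPoints.exists_violating [Finite ι] {a : ι → E} (h : HasFacetPoints a) (i : ι) :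
    ∃ x, 1 < ⟪a i, x⟫_ℝ ∧ ∀ j, j ≠ i → ⟪a j, x⟫_ℝ ≤ 1 := by
  obtain ⟨x, hx, hx'⟩ := h i
  have hev : ∀ j, ∀ᶠ s : ℝ in nhdsWithin 1 (Set.Ioi 1), j ≠ i → s * ⟪a j, x⟫_ℝ < 1 := by
    intro j
    by_cases hj : j = i
    · exact Filter.Eventually.of_forall fun _ h => absurd hj h
    have hc : ContinuousAt (fun s : ℝ => s * ⟪a j, x⟫_ℝ) 1 := by fun_prop
    have := hc.eventually_lt_const (u := 1) (by simpa using hx' j hj)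
    filter_upwards [nhdsWithin_le_nhds this] with s hs _ using hs
  obtain ⟨s, hs, hs1⟩ := ((Filter.eventually_all.2 hev).and self_mem_nhdsWithin).exists
  refine ⟨s • x, ?_, fun j hj => ?_⟩
  · rw [inner_smul_right, hx, mul_one]; exact hs1
  · rw [inner_smul_right]; exact (hs j hj).le

lemma zero_mem_interior_polarPolyhedron [Finite ι] (a : ι → E) :
    0 ∈ interior (polarPolyhedron a) := by
  rw [mem_interior_iff_mem_nhds]
  have hev : ∀ j, ∀ᶠ x in nhds (0 : E), ⟪a j, x⟫_ℝ < 1 := by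
    intro j
    have hc : ContinuousAt (fun x : E => ⟪a j, x⟫_ℝ) 0 := by fun_prop
    exact hc.eventually_lt_const (by simp)
  filter_upwards [Filter.eventually_all.2 hev] with x hx j using (hx j).le

/-- A bounded polyhedron has no nonzero recession direction. -/
lemma eq_zero_of_inner_nonpos {a : ι → E} (hb : Bornology.IsBounded (polarPolyhedron a))
    {y : E} (hy : ∀ j, ⟪a j, y⟫_ℝ ≤ 0) : y = 0 := by
  obtain ⟨C, hC⟩ := hb.exists_norm_le
  by_contra hne
  have hpos : 0 < ‖y‖ := norm_pos_iff.2 hne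
  have hC0 : 0 ≤ C := by simpa using hC 0 (fun j => by simp)
  have := hC (((C + 1) / ‖y‖) • y) (fun j => by
    rw [inner_smul_right]
    have : 0 ≤ (C + 1) / ‖y‖ := by positivity
    nlinarith [hy j])
  rw [norm_smul, Real.norm_of_nonneg (by positivity), div_mul_cancel₀ _ hpos.ne'] at this
  linarith

/-- If the `a j` lie in an affine hyperplane with normal `y`, then `y` or `-y` is a recession
direction. -/
lemma eq_zero_of_inner_eq_const {a : ι → E} (hb : Bornology.IsBounded (polarPolyhedron a))
    {y : E} {s : ℝ} (hy : ∀ j, ⟪a j, y⟫_ℝ = s) : y = 0 := by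
  rcases le_total s 0 with hs | hs
  · exact eq_zero_of_inner_nonpos hb fun j => (hy j).trans_le hs
  · refine neg_eq_zero.1 (eq_zero_of_inner_nonpos hb fun j => ?_)
    rw [inner_neg_right, hy j]; linarith

lemma isBounded_polarPolyhedron_of_sum_eq_zero [FiniteDimensional ℝ E] [Fintype ι] {v : ι → E}
    (hsum : ∑ j, v j = 0) (hsep : ∀ y, (∀ j, ⟪v j, y⟫_ℝ = 0) → y = 0) :
    Bornology.IsBounded (polarPolyhedron v) := by
  classical
  let T : E →ₗ[ℝ] (ι → ℝ) := LinearMap.pi fun j => (innerSL ℝ (v j)).toLinearMap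
  have hT : ∀ y j, T y j = ⟪v j, y⟫_ℝ := fun y j => rfl
  have hker : LinearMap.ker T = ⊥ := by
    rw [LinearMap.ker_eq_bot']
    exact fun y hy => hsep y fun j => by rw [← hT, hy]; rfl
  obtain ⟨K, -, hK⟩ := T.exists_antilipschitzWith hker
  refine (hK.isBounded_preimage (Metric.isBounded_closedBall
    (x := (0 : ι → ℝ)) (r := Fintype.card ι + 1))).subset fun y hy => ?_
  rw [Set.mem_preimage, mem_closedBall_zero_iff, pi_norm_le_iff_of_nonneg (by positivity)]
  intro j
  rw [hT, Real.norm_eq_abs, abs_le]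
  have hs : ∑ k, ⟪v k, y⟫_ℝ = 0 := by rw [← sum_inner, hsum, inner_zero_left]
  have hle : ∑ k ∈ Finset.univ.erase j, ⟪v k, y⟫_ℝ ≤ Fintype.card ι := by
    calc ∑ k ∈ Finset.univ.erase j, ⟪v k, y⟫_ℝ ≤ ∑ k ∈ Finset.univ.erase j, (1 : ℝ) :=
          Finset.sum_le_sum fun k _ => hy k
      _ ≤ Fintype.card ι := by
          simp only [Finset.sum_const, nsmul_eq_mul, mul_one]
          exact_mod_cast Finset.card_le_univ _
  rw [← Finset.add_sum_erase _ _ (Finset.mem_univ j)] at hs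
  have h0 : (0 : ℝ) ≤ Fintype.card ι := by positivity
  constructor <;> linarith [hy j]

end Polar

/-! ### Faces under projective maps -/

section Faces

variable {E : Type*} [NormedAddCommGroup E] [InnerProductSpace ℝ E]

/-- The hypothesis says that `f` pulls halfspaces back to halfspaces, which is what a projective
map does: clearing its positive denominator `w x` turns `l' (f x) ≤ m'` into `l x ≤ m`. -/
lemma IsExposed.image_of_pullback {P P' : Set E} {f : E → E} (hf : f '' P = P')
    (h : ∀ (l : StrongDual ℝ E) (m : ℝ), ∃ (l' : StrongDual ℝ E) (m' : ℝ) (w : E → ℝ),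
      ∀ x ∈ P, 0 < w x ∧ m - l x = w x * (m' - l' (f x)))
    {B : Set E} (hB : IsExposed ℝ P B) : IsExposed ℝ P' (f '' B) := by
  subst hf
  rintro ⟨_, x₀, hx₀, rfl⟩
  obtain ⟨l, hl⟩ := hB ⟨x₀, hx₀⟩
  obtain ⟨l', m', w, hw⟩ := h l (l x₀)
  have hx₀' : x₀ ∈ P ∧ ∀ y ∈ P, l y ≤ l x₀ := by rw [hl] at hx₀; exact hx₀
  have hle : ∀ x ∈ P, l' (f x) ≤ m' := fun x hx => by
    have h1 := hw x hx
    have h2 := hx₀'.2 x hx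
    have := nonneg_of_mul_nonneg_right (h1.2 ▸ sub_nonneg.2 h2) h1.1
    linarith
  have heq : ∀ x ∈ P, (l x = l x₀ ↔ l' (f x) = m') := fun x hx => by
    have h1 := hw x hx
    have : l x₀ - l x = 0 ↔ m' - l' (f x) = 0 := by
      rw [h1.2, mul_eq_zero, or_iff_right h1.1.ne']
    constructor <;> intro h3
    · linarith [this.1 (by linarith)]
    · linarith [this.2 (by linarith)]
  have h0 := (heq x₀ hx₀'.1).1 rfl
  refine ⟨l', ?_⟩
  ext y
  constructor
  · rintro ⟨x, hx, rfl⟩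
    rw [hl] at hx
    refine ⟨⟨x, hx.1, rfl⟩, ?_⟩
    rintro _ ⟨z, hz, rfl⟩
    rw [(heq x hx.1).1 (le_antisymm (hx₀'.2 x hx.1) (hx.2 x₀ hx₀'.1))]
    exact hle z hz
  · rintro ⟨⟨x, hx, rfl⟩, hmax⟩
    refine ⟨x, ?_, rfl⟩
    have h1 : l' (f x) = m' :=
      le_antisymm (hle x hx) (h0 ▸ hmax _ ⟨x₀, hx₀'.1, rfl⟩)
    rw [hl]
    exact ⟨hx, fun y hy => (hx₀'.2 y hy).trans_eq ((heq x hx).2 h1).symm⟩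

lemma nonempty_orderIso_isExposed {P P' : Set E} {f g : E → E} (hf : f '' P = P')
    (hgf : ∀ x ∈ P, g (f x) = x)
    (h : ∀ (l : StrongDual ℝ E) (m : ℝ), ∃ (l' : StrongDual ℝ E) (m' : ℝ) (w : E → ℝ),
      ∀ x ∈ P, 0 < w x ∧ m - l x = w x * (m' - l' (f x)))
    (h' : ∀ (l : StrongDual ℝ E) (m : ℝ), ∃ (l' : StrongDual ℝ E) (m' : ℝ) (w : E → ℝ),
      ∀ x ∈ P', 0 < w x ∧ m - l x = w x * (m' - l' (g x))) :
    Nonempty ({F : Set E // IsExposed ℝ P F} ≃o {F : Set E // IsExposed ℝ P' F}) := by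
  have hgP : ∀ B ⊆ P, g '' (f '' B) = B := fun B hB => by
    rw [Set.image_image, Set.image_congr fun x hx => hgf x (hB hx), Set.image_id']
  have hfP : ∀ B ⊆ P', f '' (g '' B) = B := fun B hB => by
    rw [Set.image_image]
    have : ∀ y ∈ B, f (g y) = y := fun y hy => by
      obtain ⟨x, hx, rfl⟩ := hf.symm ▸ hB hy
      rw [hgf x hx]
    rw [Set.image_congr this, Set.image_id']
  have hg : g '' P' = P := hf ▸ hgP P subset_rfl
  let e : {F : Set E // IsExposed ℝ P F} ≃ {F : Set E // IsExposed ℝ P' F} :=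
    { toFun := fun F => ⟨f '' F.1, F.2.image_of_pullback hf h⟩
      invFun := fun F => ⟨g '' F.1, F.2.image_of_pullback hg h'⟩
      left_inv := fun F => Subtype.ext (hgP _ F.2.subset)
      right_inv := fun F => Subtype.ext (hfP _ F.2.subset) }
  refine ⟨e.toOrderIso (fun F G hFG => Set.image_mono hFG) (fun F G hFG => Set.image_mono hFG)⟩

/-- The projective map `x ↦ (x - x₀) / (1 - ⟪c, x - x₀⟫)` is dual to translating the normals
by `-c`. The two positivity hypotheses say that the hyperplanes which it and its inverse send to
infinity miss the respective polyhedra. -/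
lemma nonempty_orderIso_isExposed_translate {ι : Type*} (a : ι → E) (x₀ c : E)
    (hpos : ∀ x ∈ polarPolyhedron a, 0 < 1 - ⟪c, x⟫_ℝ)
    (hpos' : ∀ y ∈ polarPolyhedron (fun j => a j - c), 0 < 1 + ⟪c, y⟫_ℝ) :
    Nonempty ({F : Set E // IsExposed ℝ {x | x - x₀ ∈ polarPolyhedron a} F} ≃o
      {F : Set E // IsExposed ℝ (polarPolyhedron fun j => a j - c) F}) := by
  refine nonempty_orderIso_isExposed
    (f := fun x => (1 - ⟪c, x - x₀⟫_ℝ)⁻¹ • (x - x₀))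
    (g := fun y => x₀ + (1 + ⟪c, y⟫_ℝ)⁻¹ • y) ?_ ?_ ?_ ?_
  · ext y
    constructor
    · rintro ⟨x, hx, rfl⟩ j
      have hp := hpos _ hx
      have hj := hx j
      rw [inner_smul_right, inner_sub_left, inv_mul_le_iff₀ hp]
      linarith
    · intro hy
      have hp := hpos' y hy
      refine ⟨x₀ + (1 + ⟪c, y⟫_ℝ)⁻¹ • y, fun j => ?_, ?_⟩
      · have hj := hy j
        rw [inner_sub_left] at hj
        rw [add_sub_cancel_left, inner_smul_right, inv_mul_le_iff₀ hp]
        linarith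
      · dsimp only
        rw [add_sub_cancel_left, inner_smul_right, smul_smul,
          show 1 - (1 + ⟪c, y⟫_ℝ)⁻¹ * ⟪c, y⟫_ℝ = (1 + ⟪c, y⟫_ℝ)⁻¹ by field_simp; ring,
          inv_inv, mul_inv_cancel₀ hp.ne', one_smul]
  · intro x hx
    have hp := hpos _ hx
    rw [inner_smul_right, smul_smul,
      show 1 + (1 - ⟪c, x - x₀⟫_ℝ)⁻¹ * ⟪c, x - x₀⟫_ℝ = (1 - ⟪c, x - x₀⟫_ℝ)⁻¹ by
        field_simp; ring,
      inv_inv, mul_inv_cancel₀ hp.ne', one_smul, add_sub_cancel]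
  · intro l m
    refine ⟨l - (m - l x₀) • innerSL ℝ c, m - l x₀, fun x => 1 - ⟪c, x - x₀⟫_ℝ,
      fun x hx => ⟨hpos _ hx, ?_⟩⟩
    have hp := hpos _ hx
    simp only [sub_apply, smul_apply, innerSL_apply_apply,
      map_smul, map_sub l, smul_eq_mul]
    field_simp
    ring
  · intro l m
    refine ⟨l + m • innerSL ℝ c, m + l x₀ + m * ⟪c, x₀⟫_ℝ, fun y => 1 + ⟪c, y⟫_ℝ,
      fun y hy => ⟨hpos' _ hy, ?_⟩⟩
    have hp := hpos' _ hy
    simp only [add_apply, smul_apply, innerSL_apply_apply,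
      map_smul, map_add l, smul_eq_mul, inner_smul_right, inner_add_right]
    field_simp
    ring

end Faces

/-! ### Normal form of a polytope -/

section NormalForm

variable {n d : ℕ}

lemma isClosedHalfspace_inner_le_one {a : EuclideanSpace ℝ (Fin d)} (ha : a ≠ 0) :
    IsClosedHalfspace {x | ⟪a, x⟫_ℝ ≤ 1} := ⟨a, 1, ha, rfl⟩

lemma isNDPolytope_polarPolyhedron {a : Fin n → EuclideanSpace ℝ (Fin d)}
    (hb : Bornology.IsBounded (polarPolyhedron a)) (hf : HasFacetPoints a) :
    IsNDPolytope n d (polarPolyhedron a) where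
  bounded := hb
  fullDim := ⟨0, zero_mem_interior_polarPolyhedron a⟩
  exists_halfspaces := by
    refine ⟨fun i => {x | ⟪a i, x⟫_ℝ ≤ 1},
      fun i => isClosedHalfspace_inner_le_one (hf.ne_zero i), ?_, fun i heq => ?_⟩
    · ext x; simp [polarPolyhedron]
    · obtain ⟨x, hx, hx'⟩ := hf.exists_violating i
      have : x ∈ polarPolyhedron a := by
        rw [← heq]
        simpa using hx'
      exact absurd (this i) (not_le.2 hx)

/-- Centre the polytope at an interior point `x₀`, where all its inequalities are strict, and
rescale them. -/
lemma IsNDPolytope.exists_eq_polarPolyhedron {P : Set (EuclideanSpace ℝ (Fin d))}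
    (hP : IsNDPolytope n d P) : ∃ (x₀ : EuclideanSpace ℝ (Fin d))
      (a : Fin n → EuclideanSpace ℝ (Fin d)), P = {x | x - x₀ ∈ polarPolyhedron a} ∧
      Bornology.IsBounded (polarPolyhedron a) ∧ HasFacetPoints a := by
  obtain ⟨x₀, hx₀⟩ := hP.fullDim
  obtain ⟨H, hH, hPH, hirr⟩ := hP.exists_halfspaces
  choose a b ha hab using hH
  have hmem : ∀ x, x ∈ P ↔ ∀ i, ⟪a i, x⟫_ℝ ≤ b i := fun x => by
    rw [hPH]; simp [hab]
  have hlt : ∀ i, 0 < b i - ⟪a i, x₀⟫_ℝ := fun i => by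
    have hc : ContinuousAt (fun t : ℝ => x₀ + t • a i) 0 := by fun_prop
    have hev : ∀ᶠ t : ℝ in nhdsWithin 0 (Set.Ioi 0), x₀ + t • a i ∈ P :=
      nhdsWithin_le_nhds (hc.eventually_mem (by simpa using mem_interior_iff_mem_nhds.1 hx₀))
    obtain ⟨t, ht, ht0⟩ := (hev.and self_mem_nhdsWithin).exists
    have h1 := (hmem _).1 ht i
    rw [inner_add_right, inner_smul_right] at h1
    have h2 : 0 < t * ⟪a i, a i⟫_ℝ := mul_pos ht0 (real_inner_self_pos.2 (ha i))
    linarith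
  let a' : Fin n → EuclideanSpace ℝ (Fin d) := fun i => (b i - ⟪a i, x₀⟫_ℝ)⁻¹ • a i
  have ha' : ∀ i x, ⟪a' i, x - x₀⟫_ℝ ≤ 1 ↔ ⟪a i, x⟫_ℝ ≤ b i := fun i x => by
    rw [real_inner_smul_left, inv_mul_le_iff₀ (hlt i), inner_sub_right]
    constructor <;> intro h <;> linarith
  have hPa : P = {x | x - x₀ ∈ polarPolyhedron a'} := by
    ext x
    rw [hmem]
    exact forall_congr' fun i => (ha' i x).symm
  refine ⟨x₀, a', hPa, ?_, fun i => ?_⟩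
  · obtain ⟨C, hC⟩ := hP.bounded.exists_norm_le
    refine isBounded_iff_forall_norm_le.2 ⟨C + ‖x₀‖, fun x hx => ?_⟩
    have := hC (x + x₀) (by rw [hPa]; simpa using hx)
    have h2 := norm_sub_le (x + x₀) x₀
    rw [add_sub_cancel_right] at h2
    linarith
  · -- A point violating only the `i`-th inequality is pulled towards the centre until the
    -- inequality becomes an equality.
    have hsub : P ⊆ ⋂ j ∈ {j | j ≠ i}, H j := by
      rw [hPH]
      exact fun x hx => Set.mem_iInter₂.2 fun j _ => Set.mem_iInter.1 hx j
    obtain ⟨z, hz, hzP⟩ := Set.exists_of_ssubset (hsub.ssubset_of_ne (hirr i).symm)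
    have hzj : ∀ j, j ≠ i → ⟪a' j, z - x₀⟫_ℝ ≤ 1 := fun j hj => by
      have := Set.mem_iInter₂.1 hz j hj
      rw [hab] at this
      exact (ha' j z).2 this
    have hzi : 1 < ⟪a' i, z - x₀⟫_ℝ := by
      by_contra hcon
      refine hzP (hPa ▸ fun j => ?_)
      by_cases hj : j = i
      · exact hj ▸ not_lt.1 hcon
      · exact hzj j hj
    have hpos : 0 < ⟪a' i, z - x₀⟫_ℝ := one_pos.trans hzi
    refine ⟨(⟪a' i, z - x₀⟫_ℝ)⁻¹ • (z - x₀), ?_, fun j hj => ?_⟩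
    · rw [inner_smul_right, inv_mul_cancel₀ hpos.ne']
    · rw [inner_smul_right, inv_mul_lt_iff₀ hpos]
      linarith [hzj j hj]

end NormalForm

/-! ### Affinely independent normals -/

section Simplex

variable {d : ℕ}

/-- The vertex opposite to the `k`-th facet is `-y k / r k`, where `z ↦ r k + ⟪y k, z⟫` is the
`k`-th barycentric coordinate with respect to the normals. -/
lemma isDSimplex_of_affineBasis (hd : d ≠ 0)
    (b : AffineBasis (Fin (d + 1)) ℝ (EuclideanSpace ℝ (Fin d)))
    (x₀ : EuclideanSpace ℝ (Fin d)) (hb : Bornology.IsBounded (polarPolyhedron b)) :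
    IsDSimplex {x | x - x₀ ∈ polarPolyhedron b} := by
  let E := EuclideanSpace ℝ (Fin d)
  let y : Fin (d + 1) → E := fun k =>
    (InnerProductSpace.toDual ℝ E).symm (LinearMap.toContinuousLinearMap (b.coord k).linear)
  let r : Fin (d + 1) → ℝ := fun k => b.coord k 0
  have hy : ∀ k z, ⟪y k, z⟫_ℝ = b.coord k z - r k := fun k z => by
    have h1 : ⟪y k, z⟫_ℝ = (b.coord k).linear z := by simp [y]
    have h2 := (b.coord k).linearMap_vsub z 0
    simpa [h1] using h2
  have hyb : ∀ k j, ⟪b j, y k⟫_ℝ = (if k = j then 1 else 0) - r k := fun k j => by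
    rw [real_inner_comm, hy, b.coord_apply]
  have hr : ∀ k, 0 < r k := fun k => by
    by_contra hk
    have h0 : -y k = 0 := eq_zero_of_inner_nonpos hb fun j => by
      rw [inner_neg_right, hyb]
      split_ifs <;> linarith
    have : Nontrivial (Fin (d + 1)) := Fin.nontrivial_iff_two_le.2 (by omega)
    obtain ⟨j, hj⟩ := exists_ne k
    have h1 := hyb k k
    have h2 := hyb k j
    rw [neg_eq_zero.1 h0, inner_zero_right] at h1 h2
    rw [if_pos rfl] at h1
    rw [if_neg hj.symm] at h2
    linarith
  have hrsum : ∑ k, r k = 1 := b.sum_coord_apply_eq_one 0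
  have hrb : ∑ k, r k • b k = 0 := b.linear_combination_coord_eq_self 0
  let p : Fin (d + 1) → E := fun k => x₀ + (-(r k)⁻¹) • y k
  have hp : ∀ k j, ⟪b j, p k - x₀⟫_ℝ = 1 - (if k = j then (r k)⁻¹ else 0) := fun k j => by
    have := (hr k).ne'
    rw [add_sub_cancel_left, inner_smul_right, hyb]
    split_ifs <;> field_simp <;> ring
  have hcomb : ∀ (w : Fin (d + 1) → ℝ) j,
      ⟪b j, ∑ k, w k • (p k - x₀)⟫_ℝ = ∑ k, w k - w j * (r j)⁻¹ := fun w j => by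
    rw [inner_sum]
    simp [inner_smul_right, hp, mul_sub, Finset.sum_sub_distrib]
  have hindep : AffineIndependent ℝ p := by
    rw [affineIndependent_iff]
    intro s w hw hwp i hi
    let w' : Fin (d + 1) → ℝ := fun k => if k ∈ s then w k else 0
    have h1 : ∑ k, w' k = 0 := by simpa [w', Finset.sum_ite_mem] using hw
    have h2 : ∑ k, w' k • p k = 0 := by
      simpa [w', ite_smul, Finset.sum_ite_mem] using hwp
    have h3 : ∑ k, w' k • (p k - x₀) = 0 := by
      simp only [smul_sub, Finset.sum_sub_distrib, ← Finset.sum_smul, h1, h2, zero_smul, sub_zero]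
    have h4 := hcomb w' i
    rw [h3, h1, inner_zero_right, zero_sub, zero_eq_neg, mul_eq_zero,
      or_iff_left (inv_ne_zero (hr i).ne')] at h4
    simpa [w', hi] using h4
  refine ⟨⟨p, hindep⟩, Set.Subset.antisymm (fun x hx => ?_) (convexHull_min ?_ ?_)⟩
  · -- The barycentric coordinates of `x` are the weighted slacks `r k * (1 - ⟪b k, x - x₀⟫)`.
    let w : Fin (d + 1) → ℝ := fun k => r k * (1 - ⟪b k, x - x₀⟫_ℝ)
    have hw0 : ∀ k, 0 ≤ w k := fun k => mul_nonneg (hr k).le (sub_nonneg.2 (hx k))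
    have hw1 : ∑ k, w k = 1 := by
      have : ∑ k, r k * ⟪b k, x - x₀⟫_ℝ = 0 := by
        simp only [← real_inner_smul_left]
        rw [← sum_inner, hrb, inner_zero_left]
      simp [w, mul_sub, Finset.sum_sub_distrib, hrsum, this]
    have hxw : ∑ k, w k • (p k - x₀) - (x - x₀) = 0 :=
      eq_zero_of_inner_eq_const hb (s := 0) fun j => by
        have := (hr j).ne'
        rw [inner_sub_right, hcomb, hw1]
        simp only [w]
        field_simp
        ring
    have hx' : ∑ k, w k • p k = x := by
      simp only [smul_sub, Finset.sum_sub_distrib, ← Finset.sum_smul, hw1, one_smul] at hxw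
      simpa [sub_eq_zero] using hxw
    rw [← hx']
    exact (convex_convexHull ℝ _).sum_mem (fun k _ => hw0 k) hw1
      fun k _ => subset_convexHull ℝ _ ⟨k, rfl⟩
  · rintro _ ⟨k, rfl⟩ j
    change ⟪b j, p k - x₀⟫_ℝ ≤ 1
    rw [hp]
    have := inv_pos.2 (hr k)
    split_ifs <;> linarith
  · intro x hx z hz s t hs ht hst j
    have hx := hx j
    have hz := hz j
    have : s • x + t • z - x₀ = s • (x - x₀) + t • (z - x₀) := by
      rw [smul_sub, smul_sub, sub_add_sub_comm, ← add_smul, hst, one_smul]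
    rw [this, inner_add_right, inner_smul_right, inner_smul_right]
    nlinarith

lemma isDSimplex_of_affineIndependent {n : ℕ} {a : Fin n → EuclideanSpace ℝ (Fin d)}
    (ha : AffineIndependent ℝ a) (hf : HasFacetPoints a) (x₀ : EuclideanSpace ℝ (Fin d))
    (hb : Bornology.IsBounded (polarPolyhedron a)) :
    IsDSimplex {x | x - x₀ ∈ polarPolyhedron a} := by
  rcases Nat.eq_zero_or_pos d with rfl | hd
  · have : Subsingleton (Fin (0 + 1)) := inferInstanceAs (Subsingleton (Fin 1))
    refine ⟨⟨fun _ => 0, affineIndependent_of_subsingleton ℝ _⟩, ?_⟩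
    ext x
    rw [Subsingleton.elim x x₀]
    simp only [Set.mem_ofPred_eq, sub_self]
    refine iff_of_true (fun j => by simp) (subset_convexHull ℝ _ ⟨0, Subsingleton.elim _ _⟩)
  have hne : Nonempty (Fin n) := by
    by_contra hn
    rw [not_nonempty_iff] at hn
    have h := eq_zero_of_inner_nonpos hb
      (y := EuclideanSpace.single (⟨0, hd⟩ : Fin d) (1 : ℝ)) (fun j => isEmptyElim j)
    simpa using congrArg norm h
  have hspan : affineSpan ℝ (Set.range a) = ⊤ := by
    rw [AffineSubspace.affineSpan_eq_top_iff_vectorSpan_eq_top_of_nonempty ℝ _ _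
      (Set.range_nonempty a), ← Submodule.orthogonal_eq_bot_iff, Submodule.eq_bot_iff]
    intro y hy
    obtain ⟨i₀⟩ := hne
    refine eq_zero_of_inner_eq_const hb (s := ⟪a i₀, y⟫_ℝ) fun j => ?_
    have := (Submodule.mem_orthogonal _ _).1 hy _
      (vsub_mem_vectorSpan ℝ (Set.mem_range_self j) (Set.mem_range_self i₀))
    rw [vsub_eq_sub, inner_sub_left] at this
    linarith
  let b : AffineBasis (Fin n) ℝ (EuclideanSpace ℝ (Fin d)) := ⟨a, ha, hspan⟩
  have hcard := b.card_eq_finrank_add_one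
  rw [Fintype.card_fin, finrank_euclideanSpace_fin] at hcard
  subst hcard
  exact isDSimplex_of_affineBasis hd.ne' b x₀ hb

end Simplex

/-! ### Affinely dependent normals -/

section Parent

variable {n d : ℕ}

/-- If the `i`-th normal depends affinely on the others, translating the normals by minus the mean
`c` of the others makes those others sum to zero while they still separate points, so that they
cut out a bounded polyhedron. -/
lemma exists_translate {a : Fin (n + 1) → EuclideanSpace ℝ (Fin d)}
    (ha : ¬ AffineIndependent ℝ a) (hf : HasFacetPoints a)
    (hb : Bornology.IsBounded (polarPolyhedron a)) :
    ∃ (i : Fin (n + 1)) (c : EuclideanSpace ℝ (Fin d)),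
      Bornology.IsBounded (polarPolyhedron fun j => a (i.succAbove j) - c) ∧
      ∀ x ∈ polarPolyhedron a, 0 < 1 - ⟪c, x⟫_ℝ := by
  rw [affineIndependent_iff_of_fintype] at ha
  push Not at ha
  obtain ⟨w, hw, hwa, i, hi⟩ := ha
  rw [Finset.weightedVSub_eq_linear_combination (hw := hw)] at hwa
  have hsep : ∀ (y : EuclideanSpace ℝ (Fin d)) (s : ℝ),
      (∀ j, ⟪a (i.succAbove j), y⟫_ℝ = s) → y = 0 := by
    intro y s hys
    have h1 : ∑ j, w j * (⟪a j, y⟫_ℝ - s) = 0 := by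
      simp only [mul_sub, Finset.sum_sub_distrib, ← Finset.sum_mul, hw, ← real_inner_smul_left]
      rw [← sum_inner, hwa]; simp
    rw [Fin.sum_univ_succAbove _ i] at h1
    simp only [hys, sub_self, mul_zero, Finset.sum_const_zero, add_zero, mul_eq_zero,
      or_iff_right hi] at h1
    refine eq_zero_of_inner_eq_const hb (s := s) fun j => ?_
    rcases Fin.eq_self_or_eq_succAbove i j with rfl | ⟨k, rfl⟩
    · linarith
    · exact hys k
  have hn : (n : ℝ) ≠ 0 := by
    rintro h0
    have h0 : n = 0 := by exact_mod_cast h0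
    subst h0
    exact hf.ne_zero i (hsep _ 0 fun j => j.elim0)
  let c := (n : ℝ)⁻¹ • ∑ j, a (i.succAbove j)
  have hsum : ∑ j, (a (i.succAbove j) - c) = 0 := by
    simp only [Finset.sum_sub_distrib, Finset.sum_const, Finset.card_univ, Fintype.card_fin, c]
    rw [← Nat.cast_smul_eq_nsmul ℝ, smul_smul, mul_inv_cancel₀ hn, one_smul, sub_self]
  refine ⟨i, c, isBounded_polarPolyhedron_of_sum_eq_zero hsum fun y hy => ?_, fun x hx => ?_⟩
  · exact hsep y ⟪c, y⟫_ℝ fun j => by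
      have := hy j
      rw [inner_sub_left] at this
      linarith
  · -- Otherwise the mean of the `⟪a j, x⟫ ≤ 1` would be at least `1`, so all of them equal `1`.
    by_contra hneg
    have hs : ∑ j, (1 - ⟪a (i.succAbove j), x⟫_ℝ) = n * (1 - ⟪c, x⟫_ℝ) := by
      have : ∑ j, ⟪a (i.succAbove j) - c, x⟫_ℝ = 0 := by rw [← sum_inner, hsum, inner_zero_left]
      simp only [inner_sub_left, Finset.sum_sub_distrib, Finset.sum_const, Finset.card_univ,
        Fintype.card_fin, nsmul_eq_mul] at this ⊢
      linarith
    have hnn : ∀ j ∈ Finset.univ, 0 ≤ 1 - ⟪a (i.succAbove j), x⟫_ℝ := fun j _ =>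
      sub_nonneg.2 (hx _)
    have hle : n * (1 - ⟪c, x⟫_ℝ) ≤ 0 :=
      mul_nonpos_of_nonneg_of_nonpos n.cast_nonneg (not_lt.1 hneg)
    have h0 := (Finset.sum_eq_zero_iff_of_nonneg hnn).1
      (le_antisymm (hs.trans_le hle) (Finset.sum_nonneg hnn))
    have hx0 := hsep x 1 fun j => by linarith [h0 j (Finset.mem_univ j)]
    subst hx0
    simp at hneg

lemma HasFacetPoints.translate {ι : Type*} {a : ι → EuclideanSpace ℝ (Fin d)}
    (hf : HasFacetPoints a) {c : EuclideanSpace ℝ (Fin d)}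
    (hpos : ∀ x ∈ polarPolyhedron a, 0 < 1 - ⟪c, x⟫_ℝ) :
    HasFacetPoints fun j => a j - c := by
  intro i
  obtain ⟨x, hx, hx'⟩ := hf i
  have hp := hpos x fun j => by
    by_cases hj : j = i
    · exact hj ▸ hx.le
    · exact (hx' j hj).le
  refine ⟨(1 - ⟪c, x⟫_ℝ)⁻¹ • x, ?_, fun j hj => ?_⟩
  · rw [inner_smul_right, inner_sub_left, hx, inv_mul_cancel₀ hp.ne']
  · rw [inner_smul_right, inner_sub_left, inv_mul_lt_iff₀ hp]
    linarith [hx' j hj]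

end Parent

theorem mainTheorem1 (n d : ℕ) (P : Set (EuclideanSpace ℝ (Fin d)))
    (hP : IsNDPolytope n d P) (hsimplex : ¬ IsDSimplex P) :
    ∃ (m : ℕ) (Q H : Set (EuclideanSpace ℝ (Fin d))),
      m + 1 = n ∧ IsNDPolytope m d Q ∧ IsClosedHalfspace H ∧
        IsNDPolytope n d (Q ∩ H) ∧ CombinatoriallyEquivalent P (Q ∩ H) := by
  obtain ⟨x₀, a, rfl, hb, hf⟩ := hP.exists_eq_polarPolyhedron
  have ha : ¬ AffineIndependent ℝ a := fun ha =>
    hsimplex (isDSimplex_of_affineIndependent ha hf x₀ hb)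
  obtain _ | m := n
  · exact absurd (affineIndependent_of_subsingleton ℝ a) ha
  obtain ⟨i, c, hbc, hpos⟩ := exists_translate ha hf hb
  have hfc := hf.translate hpos
  have hinter : polarPolyhedron (fun j => a (i.succAbove j) - c) ∩ {x | ⟪a i - c, x⟫_ℝ ≤ 1} =
      polarPolyhedron fun j => a j - c := by
    ext x
    constructor
    · rintro ⟨hx, hxi⟩ j
      rcases Fin.eq_self_or_eq_succAbove i j with rfl | ⟨k, rfl⟩
      · exact hxi
      · exact hx k
    · exact fun hx => ⟨fun j => hx _, hx i⟩
  refine ⟨m, polarPolyhedron fun j => a (i.succAbove j) - c, {x | ⟪a i - c, x⟫_ℝ ≤ 1}, rfl,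
    isNDPolytope_polarPolyhedron hbc (hfc.comp Fin.succAbove_right_injective),
    isClosedHalfspace_inner_le_one (hfc.ne_zero i), ?_⟩
  rw [hinter]
  refine ⟨isNDPolytope_polarPolyhedron (hbc.subset (hinter ▸ Set.inter_subset_left)) hfc,
    nonempty_orderIso_isExposed_translate a x₀ c hpos fun y hy => ?_⟩
  -- If `1 + ⟪c, y⟫ ≤ 0`, then `y` is a recession direction of the original polytope.
  by_contra hneg
  have hy0 : y = 0 := eq_zero_of_inner_nonpos hb fun j => by
    have := hy j
    rw [inner_sub_left] at this
    linarith
  subst hy0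
  simp at hneg
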